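/- For a group $G$ let $\widehat{G}$ be its profinite completion, with canonical homomorphism $\eta_G\colon G\to\widehat{G}$. Let $\operatorname{Aut}\widehat{G}$ be the group of continuous automorphisms of $\widehat{G}$ under composition, with the topology of uniform convergence. By functoriality every $\sigma\in\operatorname{Aut}G$ induces $\widehat{\sigma}\in\operatorname{Aut}\widehat{G}$, characterized by $\widehat{\sigma}\circ\eta_G=\eta_G\circ\sigma$. Let $F$ be the free group on $x,y$, let $\Phi$ be the free group on $a,b$, and let $\rho\colon\Phi\to\operatorname{Aut}F$ be the homomorphism with $\rho(a)=\alpha$ and $\rho(b)=\beta$, where $\alpha,\beta\in\operatorname{Aut}F$ are given by $$\alpha\colon x\mapsto x,\ y\mapsto yx^2,\qquad \beta\colon x\mapsto xy^2,\ y\mapsto y.$$ **Proposition 3.3.** There is a unique continuous homomorphism $\nu\colon\widehat{\Phi}\to\operatorname{Aut}\widehat{F}$ such that $\nu(\eta_\Phi(g))=\widehat{\rho(g)}$ for all $g\in\Phi$, and $\nu$ is injective. -/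

import Mathlib

noncomputable section

open CategoryTheory

universe u

namespace ProfAut

/-! ## Continuous automorphisms of a topological group -/

/-- The continuous automorphisms of a topological group (automorphisms that are
homeomorphisms). -/
abbrev ContAut (G : Type u) [Group G] [TopologicalSpace G] : Type u := G ≃ₜ* G

/-- The product of two automorphisms is their composition, `(f * g) x = f (g x)`. -/
instance instGroupContAut (G : Type u) [Group G] [TopologicalSpace G] : Group (ContAut G) where
  mul f g := g.trans f
  one := ContinuousMulEquiv.refl G
  inv f := f.symm
  mul_assoc _ _ _ := rfl
  one_mul _ := rfl
  mul_one _ := rfl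
  inv_mul_cancel f := ContinuousMulEquiv.ext f.symm_apply_apply

/-- The underlying continuous map of a continuous automorphism. -/
def ContAut.toCMap {G : Type u} [Group G] [TopologicalSpace G] (f : ContAut G) : C(G, G) :=
  ⟨f, f.continuous_toFun⟩

/-- The compact-open topology. For compact `G` (the only case used) this is the topology of
uniform convergence, and for a finitely generated profinite `G` it is the profinite topology of
the projective limit of the `Aut (G / U)` over the open characteristic subgroups `U`. -/
instance instTopologicalSpaceContAut (G : Type u) [Group G] [TopologicalSpace G] :
    TopologicalSpace (ContAut G) :=
  TopologicalSpace.induced ContAut.toCMap ContinuousMap.compactOpen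

theorem ContAut.mul_apply {G : Type u} [Group G] [TopologicalSpace G] (f g : ContAut G) (x : G) :
    (f * g) x = f (g x) := rfl

theorem ContAut.one_apply {G : Type u} [Group G] [TopologicalSpace G] (x : G) :
    (1 : ContAut G) x = x := rfl

/-! ## Profinite completions -/

/-- The profinite completion of a (discrete) group, as a profinite group. -/
abbrev Completion (G : Type u) [Group G] : ProfiniteGrp.{u} :=
  ProfiniteGrp.profiniteCompletion.obj (GrpCat.of G)

/-- The canonical homomorphism from a group to its profinite completion. -/
def toCompletion (G : Type u) [Group G] : G →* Completion G :=
  (ProfiniteGrp.ProfiniteCompletion.eta (GrpCat.of G)).hom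

/-- The continuous endomorphism of the profinite completion induced, by functoriality, by an
endomorphism of the group. -/
def completionMap {G : Type u} [Group G] (f : G →* G) : Completion G →ₜ* Completion G :=
  (ProfiniteGrp.profiniteCompletion.map (GrpCat.ofHom f)).hom

theorem completionMap_toCompletion {G : Type u} [Group G] (f : G →* G) (g : G) :
    completionMap f (toCompletion G g) = toCompletion G (f g) :=
  ConcreteCategory.congr_hom (ProfiniteGrp.ProfiniteCompletion.lift_eta
    (GrpCat.ofHom f ≫ ProfiniteGrp.ProfiniteCompletion.eta (GrpCat.of G))) g

theorem completionMap_id_apply {G : Type u} [Group G] (x : Completion G) :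
    completionMap (MonoidHom.id G) x = x :=
  ConcreteCategory.congr_hom (ProfiniteGrp.profiniteCompletion.map_id (GrpCat.of G)) x

theorem completionMap_comp_apply {G : Type u} [Group G] (f h : G →* G) (x : Completion G) :
    completionMap (f.comp h) x = completionMap f (completionMap h x) :=
  ConcreteCategory.congr_hom
    (ProfiniteGrp.profiniteCompletion.map_comp (GrpCat.ofHom h) (GrpCat.ofHom f)) x

/-- The natural homomorphism from the automorphism group of a group to the group of continuous
automorphisms of its profinite completion. -/
def completionAut (G : Type u) [Group G] : MulAut G →* ContAut (Completion G) where
  toFun e :=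
    { toFun := completionMap e.toMonoidHom
      invFun := completionMap e.symm.toMonoidHom
      left_inv := fun x => by
        rw [← completionMap_comp_apply]
        convert completionMap_id_apply x using 2
        congr 1
        ext g
        exact e.symm_apply_apply g
      right_inv := fun x => by
        rw [← completionMap_comp_apply]
        convert completionMap_id_apply x using 2
        congr 1
        ext g
        exact e.apply_symm_apply g
      map_mul' := map_mul _
      continuous_toFun := (completionMap e.toMonoidHom).continuous_toFun
      continuous_invFun := (completionMap e.symm.toMonoidHom).continuous_toFun }
  map_one' := ContinuousMulEquiv.ext completionMap_id_apply
  map_mul' e₁ e₂ := ContinuousMulEquiv.ext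
    (completionMap_comp_apply e₁.toMonoidHom e₂.toMonoidHom)

theorem completionAut_toCompletion {G : Type u} [Group G] (e : MulAut G) (g : G) :
    completionAut G e (toCompletion G g) = toCompletion G (e g) :=
  completionMap_toCompletion e.toMonoidHom g

/-! ## The two automorphisms of the free group of rank two -/

/-- The free group of rank two, with basis `FreeGroup.of 0`, `FreeGroup.of 1`. -/
abbrev F₂ : Type := FreeGroup (Fin 2)

/-- The first basis element of the free group of rank two. -/
def x : F₂ := FreeGroup.of 0

/-- The second basis element of the free group of rank two. -/
def y : F₂ := FreeGroup.of 1

/-- The endomorphism of the free group with `x ↦ s`, `y ↦ t`. -/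
def endo (s t : F₂) : F₂ →* F₂ := FreeGroup.lift ![s, t]

theorem endo_x (s t : F₂) : endo s t x = s := by simp [endo, x]

theorem endo_y (s t : F₂) : endo s t y = t := by simp [endo, y]

theorem hom_ext {f g : F₂ →* F₂} (hx : f x = g x) (hy : f y = g y) : f = g := by
  apply FreeGroup.ext_hom
  intro i
  fin_cases i
  · exact hx
  · exact hy

/-- The automorphism `x ↦ x`, `y ↦ y * x ^ 2`. -/
def α : MulAut F₂ :=
  MonoidHom.toMulEquiv (endo x (y * x ^ 2)) (endo x (y * (x ^ 2)⁻¹))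
    (hom_ext (by simp [endo_x]) (by simp [endo_x, endo_y]))
    (hom_ext (by simp [endo_x]) (by simp [endo_x, endo_y]))

/-- The automorphism `x ↦ x * y ^ 2`, `y ↦ y`. -/
def β : MulAut F₂ :=
  MonoidHom.toMulEquiv (endo (x * y ^ 2) y) (endo (x * (y ^ 2)⁻¹) y)
    (hom_ext (by simp [endo_x, endo_y]) (by simp [endo_y]))
    (hom_ext (by simp [endo_x, endo_y]) (by simp [endo_y]))

theorem α_x : α x = x := by simp [α, endo_x]
theorem α_y : α y = y * x ^ 2 := by simp [α, endo_y]
theorem β_x : β x = x * y ^ 2 := by simp [β, endo_x]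
theorem β_y : β y = y := by simp [β, endo_y]

/-- The homomorphism `Φ → Aut F` with `a ↦ α`, `b ↦ β`, where `Φ` is the free group on
`a = FreeGroup.of 0` and `b = FreeGroup.of 1`. -/
def ρ : FreeGroup (Fin 2) →* MulAut F₂ := FreeGroup.lift ![α, β]

end ProfAut

end

/-!
Conjugation in the profinite completion of `F ⋊ Φ` gives `ν`: since `F` is finitely generated, the
set `Hom(F, Q)` is finite for every finite group `Q`, and `F ⋊ Φ` acts on `Hom(F, Q) × Q` through
a finite group which detects all homomorphisms `F → Q`; so the completion of `F` embeds in that of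
`F ⋊ Φ`.

For the injectivity, let `q : Φ → Q` be a finite quotient. There is a monomial representation of
`F` over `Q` in which `x ^ 2` and `y ^ 2` are diagonal with entries `q(a) ^ (±1)` and
`q(b) ^ (±1)`, and on which `Φ` acts through conjugation by diagonal matrices having `q` as one of
their entries. The image in `Q` of an element `k` of the kernel of `ν` therefore commutes with
`q(a)` and `q(b)`; as `q` is arbitrary, `k` commutes with `a` and `b`. Lifting `q` to the wreath
product of a group of order two by `Q`, one sees that `k` maps into the cyclic subgroups generated
by `q(a)` and by `q(b)`. Applied to `q` together with the exponent sum of `a` modulo the order of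
`Q`, this gives `k = 1`.
-/

noncomputable section

open CategoryTheory Topology

universe u

namespace ProfAut

/-! ### Actions by continuous automorphisms -/

section ContAut

variable {A E : Type u} [Group A] [TopologicalSpace A] [Group E] [TopologicalSpace E]

instance [T2Space A] : T2Space (ContAut A) :=
  T2Space.of_injective_continuous (f := ContAut.toCMap)
    (fun _ _ h => ContinuousMulEquiv.ext fun a => DFunLike.congr_fun h a) continuous_induced_dom

/-- The continuous homomorphism to `ContAut A` given by a jointly continuous action of a
topological group `E` on `A` by automorphisms. -/
def ContAut.ofAction (φ : E →* MulAut A) (hφ : Continuous fun p : E × A => φ p.1 p.2) :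
    E →ₜ* ContAut A where
  toFun e :=
    { toMulEquiv := φ e
      continuous_toFun := hφ.comp (Continuous.prodMk_right e)
      continuous_invFun := (hφ.comp (Continuous.prodMk_right e⁻¹)).congr fun a =>
        DFunLike.congr_fun (map_inv φ e) a }
  map_one' := ContinuousMulEquiv.ext fun a => by simp [ContAut.one_apply]
  map_mul' e f := ContinuousMulEquiv.ext fun a => by simp [ContAut.mul_apply]
  continuous_toFun :=
    continuous_induced_rng.mpr (ContinuousMap.continuous_of_continuous_uncurry _ hφ)

/-- The conjugation action of a topological group `E` on a group `A` which is embedded in `E` as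
a normal subgroup. -/
def ContAut.conj [IsTopologicalGroup E] (i : A →* E) (hi : IsEmbedding i) [i.range.Normal] :
    E →ₜ* ContAut A :=
  ofAction ((MulAut.congr (i.ofInjective hi.injective).symm).toMonoidHom.comp MulAut.conjNormal)
    (hi.continuous_iff.mpr (by
      have h : Continuous fun p : E × A => p.1 * i p.2 * p.1⁻¹ := by
        have := hi.continuous
        fun_prop
      exact h.congr fun p => by simp [MulAut.congr, MonoidHom.ofInjective_apply]))

theorem ContAut.map_conj [IsTopologicalGroup E] (i : A →* E) (hi : IsEmbedding i)
    [i.range.Normal] (e : E) (a : A) : i (ContAut.conj i hi e a) = e * i a * e⁻¹ := by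
  change i ((i.ofInjective hi.injective).symm
    (MulAut.conjNormal e (i.ofInjective hi.injective a))) = _
  rw [MonoidHom.apply_ofInjective_symm, MulAut.conjNormal_apply, MonoidHom.ofInjective_apply]

end ContAut

/-! ### Finite quotients of profinite completions -/

section Completion

variable {G H : Type u} [Group G] [Group H]

theorem denseRange_toCompletion : DenseRange (toCompletion G) :=
  ProfiniteGrp.ProfiniteCompletion.denseRange (GrpCat.of G)

theorem completion_hom_ext {A : Type*} [Monoid A] [TopologicalSpace A] [T2Space A]
    {φ ψ : Completion G →ₜ* A} (h : ∀ g, φ (toCompletion G g) = ψ (toCompletion G g)) : φ = ψ :=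
  DFunLike.coe_injective <| denseRange_toCompletion.equalizer φ.continuous_toFun
    ψ.continuous_toFun (funext h)

/-- The continuous homomorphism of profinite completions induced by a homomorphism of groups;
`completionMap` is the case of an endomorphism. -/
def completionHom (f : G →* H) : Completion G →ₜ* Completion H :=
  (ProfiniteGrp.profiniteCompletion.map (GrpCat.ofHom f)).hom

@[simp]
theorem completionHom_toCompletion (f : G →* H) (g : G) :
    completionHom f (toCompletion G g) = toCompletion H (f g) :=
  ConcreteCategory.congr_hom (ProfiniteGrp.ProfiniteCompletion.lift_eta
    (GrpCat.ofHom f ≫ ProfiniteGrp.ProfiniteCompletion.eta (GrpCat.of H))) g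

theorem completionHom_range_normal (f : G →* H) [hf : f.range.Normal] :
    (completionHom f).toMonoidHom.range.Normal := by
  have hcont : Continuous (completionHom f) := (completionHom f).continuous_toFun
  refine ⟨?_⟩
  rintro _ ⟨z, rfl⟩ e
  refine (denseRange_toCompletion.prodMap denseRange_toCompletion).induction_on
    (p := fun w : Completion H × Completion G =>
      w.1 * completionHom f w.2 * w.1⁻¹ ∈ Set.range (completionHom f)) (e, z) ?_ ?_
  · exact (isCompact_range hcont).isClosed.preimage (by fun_prop)
  · rintro ⟨h, g⟩
    obtain ⟨g', hg'⟩ := hf.conj_mem (f g) ⟨g, rfl⟩ h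
    exact ⟨toCompletion G g', by simp [hg']⟩

variable {Q R : Type u} [Group Q] [Finite Q] [Group R] [Finite R]

/-- The extension to the profinite completion of a homomorphism to a finite group, which carries
no topology here; continuity is `isLocallyConstant_finiteLift`. -/
def finiteLift (q : G →* Q) : Completion G →* Q :=
  (ProfiniteGrp.ProfiniteCompletion.lift (P := .ofFiniteGrp (.of Q))
    (GrpCat.ofHom q)).hom.toMonoidHom

@[simp]
theorem finiteLift_toCompletion (q : G →* Q) (g : G) : finiteLift q (toCompletion G g) = q g :=
  ConcreteCategory.congr_hom (ProfiniteGrp.ProfiniteCompletion.lift_eta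
    (P := .ofFiniteGrp (.of Q)) (GrpCat.ofHom q)) g

theorem isLocallyConstant_finiteLift (q : G →* Q) : IsLocallyConstant (finiteLift q) := by
  have : DiscreteTopology (ProfiniteGrp.ofFiniteGrp (.of Q)) := ⟨rfl⟩
  exact fun s => (isOpen_discrete (α := ProfiniteGrp.ofFiniteGrp (.of Q)) s).preimage
    (ProfiniteGrp.ProfiniteCompletion.lift _).hom.continuous_toFun

theorem finiteLift_unique {q : G →* Q} {φ : Completion G →* Q} (hφ : IsLocallyConstant φ)
    (h : ∀ g, φ (toCompletion G g) = q g) : finiteLift q = φ := by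
  let _ : TopologicalSpace Q := ⊥
  have : DiscreteTopology Q := ⟨rfl⟩
  exact DFunLike.coe_injective <| denseRange_toCompletion.equalizer
    (isLocallyConstant_finiteLift q).continuous hφ.continuous
    (funext fun g => by simp [h])

theorem finiteLift_comp_right (q : H →* Q) (f : G →* H) (z : Completion G) :
    finiteLift (q.comp f) z = finiteLift q (completionHom f z) :=
  DFunLike.congr_fun (finiteLift_unique
    (φ := (finiteLift q).comp (completionHom f).toMonoidHom)
    ((isLocallyConstant_finiteLift q).comp_continuous (completionHom f).continuous_toFun)
    fun g => by simp) z

theorem finiteLift_comp_left (m : Q →* R) (q : G →* Q) (z : Completion G) :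
    finiteLift (m.comp q) z = m (finiteLift q z) :=
  DFunLike.congr_fun (finiteLift_unique (φ := m.comp (finiteLift q))
    ((isLocallyConstant_finiteLift q).comp m) fun g => by simp) z

theorem eq_one_of_finiteLift_eq_one {z : Completion G}
    (h : ∀ (Q : Type u) [Group Q] [Finite Q] (q : G →* Q), finiteLift q z = 1) : z = 1 := by
  by_contra hz
  obtain ⟨N, hN⟩ := ProfiniteGrp.exist_openNormalSubgroup_sub_open_nhds_of_one
    (isOpen_compl_singleton (x := z)) (Ne.symm hz)
  have : Finite (Completion G ⧸ N.toSubgroup) := Subgroup.quotient_finite_of_isOpen _ N.isOpen'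
  have : DiscreteTopology (Completion G ⧸ N.toSubgroup) :=
    QuotientGroup.discreteTopology N.isOpen'
  have hmk : finiteLift ((QuotientGroup.mk' N.toSubgroup).comp (toCompletion G))
      = QuotientGroup.mk' N.toSubgroup :=
    finiteLift_unique (fun s => (isOpen_discrete (α := Completion G ⧸ N.toSubgroup) s).preimage
      continuous_quot_mk) fun _ => rfl
  have hzN : z ∈ N.toSubgroup := by
    rw [← QuotientGroup.eq_one_iff, ← QuotientGroup.mk'_apply, ← hmk]
    exact h _ _
  exact hN hzN rfl

theorem commute_of_finiteLift {z w : Completion G}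
    (h : ∀ (Q : Type u) [Group Q] [Finite Q] (q : G →* Q),
      Commute (finiteLift q z) (finiteLift q w)) : Commute z w := by
  rw [← commutatorElement_eq_one_iff_commute]
  refine eq_one_of_finiteLift_eq_one fun Q _ _ q => ?_
  rw [map_commutatorElement, commutatorElement_eq_one_iff_commute]
  exact h Q q

theorem completionHom_injective (f : G →* H)
    (hf : ∀ (Q : Type u) [Group Q] [Finite Q] (q : G →* Q),
      ∃ (R : Type u) (_ : Group R) (_ : Finite R) (r : H →* R), (r.comp f).ker ≤ q.ker) :
    Function.Injective (completionHom f) := by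
  refine (injective_iff_map_eq_one _).mpr fun z hz =>
    eq_one_of_finiteLift_eq_one fun Q _ _ q => ?_
  obtain ⟨R, _, _, r, hr⟩ := hf Q q
  obtain ⟨g, hg⟩ : ∃ g, finiteLift (q.prod (r.comp f)) z = (q.prod (r.comp f)) g := by
    obtain ⟨_, h, g, rfl⟩ := mem_closure_iff.mp (denseRange_toCompletion z) _
      ((isLocallyConstant_finiteLift (q.prod (r.comp f))).isOpen_fiber _) rfl
    exact ⟨g, by simpa using h.symm⟩
  have hq := finiteLift_comp_left (MonoidHom.fst Q R) (q.prod (r.comp f)) z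
  have hr' := finiteLift_comp_left (MonoidHom.snd Q R) (q.prod (r.comp f)) z
  rw [hg, MonoidHom.fst_comp_prod] at hq
  rw [hg, MonoidHom.snd_comp_prod, finiteLift_comp_right, hz, map_one] at hr'
  exact hq.trans (hr hr'.symm)

end Completion

/-! ### Extending an action on a finitely generated group to the completions -/

section CompletionAct

theorem finite_monoidHom_of_fg (N Q : Type*) [Group N] [Group.FG N] [Group Q] [Finite Q] :
    Finite (N →* Q) := by
  obtain ⟨S, hS, hfin⟩ := Group.fg_iff.mp ‹Group.FG N›
  have := hfin.to_subtype
  exact Finite.of_injective (fun (f : N →* Q) (s : S) => f s) fun f g h =>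
    MonoidHom.eq_of_eqOn_dense hS fun s hs => congrFun h ⟨s, hs⟩

variable {N Γ : Type u} [Group N] [Group Γ] (φ : Γ →* MulAut N)

/-- The action of `N ⋊[φ] Γ` on `Hom(N, Q) × Q`, as a homomorphism to a permutational wreath
product: `Γ` permutes the homomorphisms `N →* Q`, and `N` acts on the fibre `Q` over `h` by
multiplication through `h`. -/
def homWreath (Q : Type u) [Group Q] :
    N ⋊[φ] Γ →* ((N →* Q) → Q) ⋊[mulAutArrow] Equiv.Perm (N →* Q) :=
  SemidirectProduct.map (MonoidHom.pi id)
    { toFun g := (φ g).monoidHomCongrLeftEquiv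
      map_one' := by rw [map_one]; rfl
      map_mul' g h := by rw [map_mul]; rfl }
    fun g => by
      ext n h
      rfl

variable [Group.FG N]

theorem completionHom_inl_injective :
    Function.Injective (completionHom (SemidirectProduct.inl : N →* N ⋊[φ] Γ)) := by
  refine completionHom_injective _ fun Q _ _ q => ?_
  have := finite_monoidHom_of_fg N Q
  refine ⟨_, _, Finite.of_equiv _ SemidirectProduct.equivProd.symm, homWreath φ Q, fun n hn => ?_⟩
  exact congrFun (congrArg SemidirectProduct.left hn) q

theorem isEmbedding_completionHom_inl :
    IsEmbedding (completionHom (SemidirectProduct.inl : N →* N ⋊[φ] Γ)) :=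
  ((completionHom SemidirectProduct.inl).continuous_toFun.isClosedEmbedding
    (completionHom_inl_injective φ)).isEmbedding

instance : (completionHom (SemidirectProduct.inl : N →* N ⋊[φ] Γ)).toMonoidHom.range.Normal :=
  have : (SemidirectProduct.inl : N →* N ⋊[φ] Γ).range.Normal := by
    rw [SemidirectProduct.range_inl_eq_ker_rightHom]
    infer_instance
  completionHom_range_normal _

/-- The continuous action of the completion of `Γ` on the completion of the finitely generated
group `N` which extends `φ`: conjugation in the completion of `N ⋊[φ] Γ`. -/
def completionAct : Completion Γ →ₜ* ContAut (Completion N) :=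
  (ContAut.conj (completionHom SemidirectProduct.inl).toMonoidHom
    (isEmbedding_completionHom_inl φ)).comp (completionHom SemidirectProduct.inr)

theorem completionHom_inl_completionAct (k : Completion Γ) (z : Completion N) :
    completionHom (SemidirectProduct.inl : N →* N ⋊[φ] Γ) (completionAct φ k z)
      = completionHom SemidirectProduct.inr k * completionHom SemidirectProduct.inl z
        * (completionHom SemidirectProduct.inr k)⁻¹ :=
  ContAut.map_conj _ (isEmbedding_completionHom_inl φ) _ z

theorem completionAct_toCompletion (g : Γ) :
    completionAct φ (toCompletion Γ g) = completionAut N (φ g) := by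
  refine ContinuousMulEquiv.ext fun z => congrFun (denseRange_toCompletion.equalizer
    (completionAct φ (toCompletion Γ g)).continuous_toFun
    (completionAut N (φ g)).continuous_toFun (funext fun n => ?_)) z
  refine completionHom_inl_injective φ ?_
  refine (completionHom_inl_completionAct φ _ _).trans ?_
  change _ = completionHom SemidirectProduct.inl (completionAut N (φ g) (toCompletion N n))
  simp [completionAut_toCompletion, SemidirectProduct.inl_aut]

theorem finiteLift_completionAct {W : Type u} [Group W] [Finite W] {P : N →* W} {D : Γ →* W}
    (h : ∀ g n, P (φ g n) = D g * P n * (D g)⁻¹) (k : Completion Γ) (z : Completion N) :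
    finiteLift P (completionAct φ k z)
      = finiteLift D k * finiteLift P z * (finiteLift D k)⁻¹ := by
  let w : N ⋊[φ] Γ →* W := SemidirectProduct.lift P D fun g => MonoidHom.ext (h g)
  have hP : w.comp SemidirectProduct.inl = P := SemidirectProduct.lift_comp_inl ..
  have hD : w.comp SemidirectProduct.inr = D := SemidirectProduct.lift_comp_inr ..
  simp only [← hP, ← hD, finiteLift_comp_right, completionHom_inl_completionAct, map_mul, map_inv]

end CompletionAct

/-! ### Centralizers in free profinite groups -/

theorem right_mem_zpowers_of_commute_mulSingle {D Q : Type*} [Group D] [Group Q] [DecidableEq Q]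
    {d : D} (hd : d ≠ 1) {u : Q} (hu : IsOfFinOrder u) {g : D ≀ᵣ Q}
    (h : Commute g ⟨Pi.mulSingle 1 d, u⟩) : g.right ∈ Subgroup.zpowers u := by
  by_contra hg
  -- Along the cycle of the powers of `u`, the coordinates of `g.left` pick up the factor `d` once.
  have hcoord (n : ℕ) : g.left (u ^ n) = (Pi.mulSingle 1 d : Q → D) (u ^ n)
      * g.left (u⁻¹ * u ^ n) := by
    have hne : g.right⁻¹ * u ^ n ≠ 1 := fun h1 =>
      hg (inv_mul_eq_one.mp h1 ▸ Subgroup.npow_mem_zpowers u n)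
    simpa [Pi.mulSingle_eq_of_ne hne] using
      congrFun (congrArg RegularWreathProduct.left h.eq) (u ^ n)
  have hconst (n : ℕ) (hn : n < orderOf u) : g.left (u ^ n) = g.left 1 := by
    induction n with
    | zero => rw [pow_zero]
    | succ n ih =>
      have hne : u ^ (n + 1) ≠ 1 := pow_ne_one_of_lt_orderOf n.succ_ne_zero hn
      rw [hcoord, Pi.mulSingle_eq_of_ne hne, one_mul, pow_succ', inv_mul_cancel_left,
        ih (n.lt_succ_self.trans hn)]
  have hinv : u⁻¹ = u ^ (orderOf u - 1) := by
    rw [inv_eq_iff_mul_eq_one, ← pow_succ', Nat.sub_add_cancel hu.orderOf_pos, pow_orderOf_eq_one]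
  have hone := hcoord 0
  rw [pow_zero, Pi.mulSingle_eq_same, mul_one, hinv,
    hconst _ (Nat.sub_lt hu.orderOf_pos one_pos)] at hone
  exact hd (right_eq_mul.mp hone)

section FreeGroup

variable {ι : Type u} {z : Completion (FreeGroup ι)}

theorem finiteLift_mem_zpowers_of_commute {i : ι}
    (h : Commute z (toCompletion _ (FreeGroup.of i))) {Q : Type u} [Group Q] [Finite Q]
    (q : FreeGroup ι →* Q) : finiteLift q z ∈ Subgroup.zpowers (q (FreeGroup.of i)) := by
  classical
  let s : FreeGroup ι →* ℤˣ ≀ᵣ Q := FreeGroup.lift fun j =>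
    ⟨if j = i then Pi.mulSingle 1 (-1) else 1, q (FreeGroup.of j)⟩
  have hs : RegularWreathProduct.rightHom.comp s = q := by
    ext j
    simp [s]
  have hcomm := h.map (finiteLift s)
  rw [finiteLift_toCompletion, FreeGroup.lift_apply_of, if_pos rfl] at hcomm
  rw [← hs, finiteLift_comp_left, hs]
  exact right_mem_zpowers_of_commute_mulSingle (by decide) (isOfFinOrder_of_finite _) hcomm

theorem eq_one_of_commute_of_commute {i j : ι} (hij : i ≠ j)
    (hi : Commute z (toCompletion _ (FreeGroup.of i)))
    (hj : Commute z (toCompletion _ (FreeGroup.of j))) : z = 1 := by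
  classical
  refine eq_one_of_finiteLift_eq_one fun Q _ _ q => ?_
  -- `e` is the exponent sum of the `i`-th generator modulo the order of `Q`: recording it next to
  -- `q` forces a common power of the two generators to be trivial in `Q`.
  have : NeZero (Nat.card Q) := ⟨Nat.card_pos.ne'⟩
  have : Finite (Multiplicative (ZMod (Nat.card Q))) := inferInstanceAs (Finite (ZMod _))
  let e : FreeGroup ι →* Multiplicative (ZMod (Nat.card Q)) :=
    FreeGroup.lift (Pi.mulSingle i (Multiplicative.ofAdd 1))
  obtain ⟨m, hm⟩ := finiteLift_mem_zpowers_of_commute hi (q.prod e)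
  obtain ⟨n, hn⟩ := finiteLift_mem_zpowers_of_commute hj (q.prod e)
  have hdvd : (Nat.card Q : ℤ) ∣ m := by
    have he : Multiplicative.ofAdd (1 : ZMod (Nat.card Q)) ^ m = 1 := by
      simpa [e, hij.symm] using congrArg Prod.snd (hm.trans hn.symm)
    rw [← ofAdd_zsmul, ofAdd_eq_one, zsmul_one] at he
    exact (ZMod.intCast_zmod_eq_zero_iff_dvd _ _).mp he
  obtain ⟨l, rfl⟩ := hdvd
  have hq := finiteLift_comp_left (MonoidHom.fst _ _) (q.prod e) z
  rw [MonoidHom.fst_comp_prod, ← hm] at hq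
  simpa [zpow_mul] using hq

end FreeGroup

/-! ### A monomial representation of the free group of rank two -/

theorem map_eq_conj_map_of_generators {ι κ W : Type*} [Group W]
    {φ : FreeGroup ι →* MulAut (FreeGroup κ)} {P : FreeGroup κ →* W} {D : FreeGroup ι →* W}
    (h : ∀ i j, P (φ (.of i) (.of j)) * D (.of i) = D (.of i) * P (.of j))
    (g : FreeGroup ι) (n : FreeGroup κ) : P (φ g n) = D g * P n * (D g)⁻¹ := by
  induction g using FreeGroup.induction_on generalizing n with
  | C1 => simp
  | of i =>
    have hi : P.comp (φ (.of i)).toMonoidHom = (MulAut.conj (D (.of i))).toMonoidHom.comp P :=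
      FreeGroup.ext_hom _ _ fun j => eq_mul_inv_of_mul_eq (h i j)
    exact DFunLike.congr_fun hi n
  | inv_of i hi =>
    have hn := hi ((φ (.of i))⁻¹ n)
    rw [MulAut.apply_inv_self] at hn
    simp [hn, mul_assoc]
  | mul g g' hg hg' => simp [hg, hg', mul_assoc]

/-- The inclusion of the base group in a regular wreath product, used for diagonal matrices. -/
def wreathBase (D Q : Type*) [Group D] [Group Q] : (Q → D) →* D ≀ᵣ Q where
  toFun f := ⟨f, 1⟩
  map_one' := rfl
  map_mul' f f' := by ext <;> simp

theorem wreathBase_injective (D Q : Type*) [Group D] [Group Q] :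
    Function.Injective (wreathBase D Q) :=
  fun _ _ h => congrArg RegularWreathProduct.left h

theorem wreath_ext_units {G : Type*} {g h : G ≀ᵣ (ℤˣ × ℤˣ)} (hr : g.right = h.right)
    (h₁ : g.left (1, 1) = h.left (1, 1)) (h₂ : g.left (1, -1) = h.left (1, -1))
    (h₃ : g.left (-1, 1) = h.left (-1, 1)) (h₄ : g.left (-1, -1) = h.left (-1, -1)) : g = h := by
  refine RegularWreathProduct.ext (funext fun ⟨s, t⟩ => ?_) hr
  rcases Int.units_eq_one_or s with rfl | rfl <;> rcases Int.units_eq_one_or t with rfl | rfl <;>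
    assumption

section Monomial

variable {G : Type*} [Group G]

/-- The representation of `F₂` by monomial matrices over `G` with rows indexed by
`V = {±1} × {±1}`, an element of the wreath product standing for a permutation of `V` with
coefficients in `G`: the generators `x` and `y` negate the two coordinates of `V`. The
coefficients are chosen so that `x ^ 2` and `y ^ 2` are diagonal and, as a result, `α` and `β`
turn into conjugation by the diagonal matrices `diagonalRep`. -/
def monomialRep (a b : G) : F₂ →* G ≀ᵣ (ℤˣ × ℤˣ) :=
  FreeGroup.lift ![⟨fun v => if v.1 = 1 then 1 else a ^ (-v.2 : ℤ), (-1, 1)⟩,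
    ⟨fun v => if v.2 = 1 then 1 else b ^ (-v.1 : ℤ), (1, -1)⟩]

/-- The diagonal matrices over `G`, with rows indexed as for `monomialRep`, that implement the
action `ρ` on `monomialRep a b` by conjugation. The entry at `1` is the homomorphism with
`FreeGroup.of 0 ↦ a` and `FreeGroup.of 1 ↦ b`. -/
def diagonalRep (a b : G) : FreeGroup (Fin 2) →* (ℤˣ × ℤˣ → G) :=
  FreeGroup.lift ![fun v => if v.2 = 1 then a else 1, fun v => if v.1 = 1 then b else 1]

variable (a b : G)

theorem monomialRep_x_sq :
    monomialRep a b (x ^ 2) = wreathBase G (ℤˣ × ℤˣ) fun v => a ^ (-v.2 : ℤ) := by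
  apply wreath_ext_units <;> simp [monomialRep, wreathBase, x, pow_two]

theorem monomialRep_y_sq :
    monomialRep a b (y ^ 2) = wreathBase G (ℤˣ × ℤˣ) fun v => b ^ (-v.1 : ℤ) := by
  apply wreath_ext_units <;> simp [monomialRep, wreathBase, y, pow_two]

theorem monomialRep_ρ (g : FreeGroup (Fin 2)) (f : F₂) :
    monomialRep a b (ρ g f) = wreathBase _ _ (diagonalRep a b g) * monomialRep a b f
      * (wreathBase _ _ (diagonalRep a b g))⁻¹ := by
  refine map_eq_conj_map_of_generators (D := (wreathBase _ _).comp (diagonalRep a b))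
    (Fin.forall_fin_two.mpr ⟨Fin.forall_fin_two.mpr ⟨?_, ?_⟩, Fin.forall_fin_two.mpr ⟨?_, ?_⟩⟩) g f
  · change monomialRep a b (α x) * _ = _ * monomialRep a b x
    rw [α_x]
    apply wreath_ext_units <;> simp [monomialRep, wreathBase, diagonalRep, x]
  · change monomialRep a b (α y) * _ = _ * monomialRep a b y
    rw [α_y, map_mul, monomialRep_x_sq]
    apply wreath_ext_units <;> simp [monomialRep, wreathBase, diagonalRep, y]
  · change monomialRep a b (β x) * _ = _ * monomialRep a b x
    rw [β_x, map_mul, monomialRep_y_sq]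
    apply wreath_ext_units <;> simp [monomialRep, wreathBase, diagonalRep, x]
  · change monomialRep a b (β y) * _ = _ * monomialRep a b y
    rw [β_y]
    apply wreath_ext_units <;> simp [monomialRep, wreathBase, diagonalRep, y]

theorem evalOne_comp_diagonalRep (q : FreeGroup (Fin 2) →* G) :
    (Pi.evalMonoidHom _ 1).comp
      (diagonalRep (q (FreeGroup.of 0)) (q (FreeGroup.of 1))) = q := by
  ext i
  fin_cases i <;> simp [diagonalRep]

end Monomial

theorem commute_finiteLift_of_completionAct_eq_one {k : Completion (FreeGroup (Fin 2))}
    (hk : completionAct ρ k = 1) {Q : Type} [Group Q] [Finite Q]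
    (q : FreeGroup (Fin 2) →* Q) {f : F₂} {c : ℤˣ × ℤˣ → Q}
    (hf : monomialRep (q (.of 0)) (q (.of 1)) f = wreathBase _ _ c) :
    Commute (finiteLift q k) (c 1) := by
  set D := diagonalRep (q (.of 0)) (q (.of 1))
  have hconj := finiteLift_completionAct ρ (P := monomialRep (q (.of 0)) (q (.of 1)))
    (D := (wreathBase _ _).comp D) (monomialRep_ρ _ _) k (toCompletion _ f)
  rw [hk, ContAut.one_apply, finiteLift_toCompletion, hf, finiteLift_comp_left,
    eq_mul_inv_iff_mul_eq] at hconj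
  have hcomm : Commute (finiteLift D k) c :=
    Commute.of_map (wreathBase_injective Q (ℤˣ × ℤˣ)) hconj.symm
  have heval := hcomm.map (Pi.evalMonoidHom (fun _ => Q) 1)
  rwa [← finiteLift_comp_left, evalOne_comp_diagonalRep] at heval

theorem completionAct_ρ_injective : Function.Injective (completionAct ρ) := by
  refine (injective_iff_map_eq_one _).mpr fun k hk => ?_
  have ha : Commute k (toCompletion _ (.of 0)) := commute_of_finiteLift fun Q _ _ q => by
    simpa using commute_finiteLift_of_completionAct_eq_one hk q (monomialRep_x_sq _ _)
  have hb : Commute k (toCompletion _ (.of 1)) := commute_of_finiteLift fun Q _ _ q => by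
    simpa using commute_finiteLift_of_completionAct_eq_one hk q (monomialRep_y_sq _ _)
  exact eq_one_of_commute_of_commute zero_ne_one ha hb

end ProfAut

end

/-- The composite of `Φ → Aut F → Aut F̂` extends to exactly one continuous homomorphism `ν` from
the profinite completion of `Φ` to `Aut F̂`, and this `ν` is injective. -/
theorem proposition3p3 :
    ∃ ν : ProfAut.Completion (FreeGroup (Fin 2)) →ₜ* ProfAut.ContAut (ProfAut.Completion ProfAut.F₂),
      (∀ g : FreeGroup (Fin 2),
        ν (ProfAut.toCompletion (FreeGroup (Fin 2)) g)
          = ProfAut.completionAut ProfAut.F₂ (ProfAut.ρ g)) ∧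
      (∀ ν' : ProfAut.Completion (FreeGroup (Fin 2)) →ₜ*
            ProfAut.ContAut (ProfAut.Completion ProfAut.F₂),
        (∀ g : FreeGroup (Fin 2),
          ν' (ProfAut.toCompletion (FreeGroup (Fin 2)) g)
            = ProfAut.completionAut ProfAut.F₂ (ProfAut.ρ g)) → ν' = ν) ∧
      Function.Injective ν := by
  refine ⟨ProfAut.completionAct ProfAut.ρ, ProfAut.completionAct_toCompletion ProfAut.ρ,
    fun ν' hν' => ProfAut.completion_hom_ext fun g => ?_, ProfAut.completionAct_ρ_injective⟩
  rw [hν', ProfAut.completionAct_toCompletion]
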